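/- Let $n=2^{v(n)}\tilde n$ be an even positive integer with $\tilde n$ odd, let $q=2^m$ with $m\ge 1$, and let $\theta$ be the automorphism $\theta(\beta)=\beta^{2^r}$ of $\mathbb{F}_q$, where $r\in\{1,\dots,m\}$. Let $|\theta|$ be the order of $\theta$ and assume $\gcd(n,|\theta|)=1$. A linear code $C\subseteq\mathbb{F}_q^n$ is $\theta$-cyclic if $(c_0,\dots,c_{n-1})\in C$ implies $(\theta(c_{n-1}),\theta(c_0),\dots,\theta(c_{n-2}))\in C$; it is cyclic if this holds with the identity in place of $\theta$; it is Euclidean self-dual if $C=C^\perp$ for the form $[c,c']=\sum_{i=0}^{n-1}c_ic'_i$. The generator polynomial of a cyclic code $C$ of length $n$ is the monic divisor $g$ of $x^n-1$ that generates $C$ as an ideal of $\mathbb{F}_q[x]/(x^n-1)$. Let $\alpha$ be a primitive $\tilde n$-th root of unity in an extension field of $\mathbb{F}_q$. The $2^m$-cyclotomic coset of $s\in\mathbb{Z}/\tilde n\mathbb{Z}$ is $\{2^{mk}s : k\ge 0\}$. Let $\mathcal{A}$ be the collection of all multisets $A$ of residues modulo $\tilde n$ that are unions, with repetitions counted, of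 $2^m$-cyclotomic cosets and represent the generator polynomial $g$ of a Euclidean self-dual cyclic code of length $n$ over $\mathbb{F}_q$, in the sense that $g(x)=\prod_{a\in A}(x-\alpha^a)$. Let $\Lambda_r$ be the map on multisets induced by $a\mapsto 2^r a \pmod{\tilde n}$. For an odd positive integer $j$ put $\chi(j,m)=0$ if $j$ divides $(2^m)^k+1$ for some integer $k\ge 0$, and $\chi(j,m)=1$ otherwise; let $\phi$ be Euler's function and $\mathrm{ord}_j(2^m)$ the smallest positive integer $e$ such that $j$ divides $(2^m)^e-1$. Then $\mathcal{A}$ is finite, $\Lambda_r$ maps $\mathcal{A}$ into itself, and the number of Euclidean self-dual $\theta$-cyclic codes of length $n$ over $\mathbb{F}_q$ is \[ \left(1+2^{v(n)}\right)^{\frac12\sum_{j\mid\tilde n}\chi(j,m)\,\phi(j)/\mathrm{ord}_j(2^m)}-\overline{\Lambda}_r, \] where $\overline{\Lambda}_r$ is the number of $A\in\mathcal{A}$ with $\Lambda_r(A)\neq A$. -/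

import Mathlib

namespace SkewCode

/-- The shift `T_θ (c₀, …, c_{n-1}) = (θ c_{n-1}, θ c₀, …, θ c_{n-2})`.
The subtraction `i - 1` in `Fin n` is modulo `n`. -/
def skewShift {F : Type*} [Field F] {n : ℕ} [NeZero n] (θ : RingAut F) (c : Fin n → F) :
    Fin n → F :=
  fun i => θ (c (i - 1))

/-- A linear code `C` of length `n` is `θ`-cyclic if it is closed under `T_θ`. -/
def IsSkewCyclic {F : Type*} [Field F] {n : ℕ} [NeZero n] (θ : RingAut F)
    (C : Submodule F (Fin n → F)) : Prop :=
  ∀ c ∈ C, skewShift θ c ∈ C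

/-- A cyclic code is a `θ`-cyclic code for the identity automorphism. -/
def IsCyclicCode {F : Type*} [Field F] {n : ℕ} [NeZero n]
    (C : Submodule F (Fin n → F)) : Prop :=
  IsSkewCyclic (1 : RingAut F) C

/-- The Euclidean dual `{c' | [c, c'] = 0 for all c ∈ C}`, where `[c, c'] = ∑ i, c i * c' i`. -/
def euclideanDual {F : Type*} [Field F] {n : ℕ} (C : Submodule F (Fin n → F)) :
    Submodule F (Fin n → F) where
  carrier := {c' | ∀ c ∈ C, ∑ i, c i * c' i = 0}
  add_mem' := by
    intro a b ha hb c hc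
    simp [mul_add, Finset.sum_add_distrib, ha c hc, hb c hc]
  zero_mem' := by
    intro c _
    simp
  smul_mem' := by
    intro t a ha c hc
    have h : ∑ i, c i * (t • a) i = t * ∑ i, c i * a i := by
      rw [Finset.mul_sum]
      refine Finset.sum_congr rfl fun i _ => ?_
      simp only [Pi.smul_apply, smul_eq_mul]
      ring
    rw [h, ha c hc, mul_zero]

/-- A linear code is Euclidean self-dual if it equals its Euclidean dual. -/
def IsSelfDual {F : Type*} [Field F] {n : ℕ} (C : Submodule F (Fin n → F)) : Prop :=
  C = euclideanDual C

open Polynomial in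
/-- The polynomial `c₀ + c₁ X + ⋯ + c_{n-1} X^{n-1}` of a word `c`. -/
noncomputable def wordPoly {F : Type*} [Field F] {n : ℕ} (c : Fin n → F) : F[X] :=
  ∑ i : Fin n, C (c i) * X ^ (i : ℕ)

open Polynomial in
/-- `g` is the generator polynomial of the code `D` of length `n`: it is a monic divisor of
`X ^ n - 1`, and `D` is the ideal of `F[X] / (X ^ n - 1)` generated by `g`
(as `g` divides `X ^ n - 1`, a word lies in that ideal iff `g` divides its polynomial). -/
def IsGeneratorPoly {F : Type*} [Field F] {n : ℕ} (D : Submodule F (Fin n → F)) (g : F[X]) :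
    Prop :=
  g.Monic ∧ g ∣ X ^ n - 1 ∧ ∀ c : Fin n → F, c ∈ D ↔ g ∣ wordPoly c

open Classical in
/-- The `q`-cyclotomic coset `{s, s q, s q², …}` of `s` modulo `N`. -/
noncomputable def cyclotomicCoset (q : ℕ) {N : ℕ} [NeZero N] (s : ZMod N) : Finset (ZMod N) :=
  Finset.univ.filter fun a => ∃ k : ℕ, a = (q : ZMod N) ^ k * s

/-- The multiset `A` is a union, with repetitions counted, of `q`-cyclotomic cosets modulo `N`. -/
def IsCosetUnion (q : ℕ) {N : ℕ} [NeZero N] (A : Multiset (ZMod N)) : Prop :=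
  ∃ S : Multiset (ZMod N), A = (S.map fun s => (cyclotomicCoset q s).val).sum

open Polynomial in
/-- `A` represents `g` with respect to `α`: the roots of `g`, with multiplicity, are the
powers `α ^ a` for `a` in the multiset `A`, that is, `g = ∏_{a ∈ A} (X - α ^ a)`. -/
def Represents {F K : Type*} [Field F] [Field K] [Algebra F K] {N : ℕ} (α : K)
    (A : Multiset (ZMod N)) (g : F[X]) : Prop :=
  g.map (algebraMap F K) = (A.map fun a => X - C (α ^ a.val)).prod

open Polynomial in
/-- The collection of the unions (with repetition) of `q`-cyclotomic cosets modulo `N`, `q = |F|`,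
that represent the generator polynomials of the Euclidean self-dual cyclic codes of length `n`
over `F`. -/
def generatorUnions (F : Type*) {K : Type*} [Field F] [Field K] [Algebra F K]
    (n N : ℕ) [NeZero n] [NeZero N] (α : K) : Set (Multiset (ZMod N)) :=
  {A | IsCosetUnion (Nat.card F) A ∧
    ∃ (D : Submodule F (Fin n → F)) (g : F[X]),
      IsCyclicCode D ∧ IsSelfDual D ∧ IsGeneratorPoly D g ∧ Represents α A g}

/-- The map on multisets of residues induced by `a ↦ 2 ^ r * a` modulo `N`. -/
def frobMap (r : ℕ) {N : ℕ} (A : Multiset (ZMod N)) : Multiset (ZMod N) :=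
  A.map fun a => (2 : ZMod N) ^ r * a

/-- The pair `(j, m)` is good if `j` divides `(2 ^ m) ^ k + 1` for some `k ≥ 0`. -/
def IsGood (j m : ℕ) : Prop := ∃ k : ℕ, j ∣ (2 ^ m) ^ k + 1

open Classical in
/-- `χ(j, m)` is `0` if `(j, m)` is good and `1` otherwise. -/
noncomputable def chi (j m : ℕ) : ℕ := if IsGood j m then 0 else 1

/-- `(1 + 2 ^ v) ^ (½ ∑_{j ∣ N} χ(j, m) φ(j) / ord_j(2 ^ m))`, as a real power. -/
noncomputable def cyclicCount (v N m : ℕ) : ℝ :=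
  (1 + 2 ^ v : ℝ) ^ ((1 / 2 : ℝ) * ∑ j ∈ N.divisors,
    (chi j m : ℝ) * (Nat.totient j : ℝ) / (orderOf ((2 : ZMod j) ^ m) : ℝ))

end SkewCode

/-! The count becomes a count of multisets of exponents. As `n` is prime to the order of `θ`, some
multiple `nk` is `1` modulo that order; `nk` skew shifts then restore all positions and apply `θ` to
each coordinate. Hence a code is `θ`-cyclic iff it is cyclic and stable under `θ` coordinatewise
(`isSkewCyclic_iff`), that is, iff it is cyclic and `θ` fixes the coefficients of its generator `g`.

The code of `g` is self-dual iff `g` times its reverse is `X ^ n - 1` up to a unit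
(`isSelfDual_multiplesCode_iff`). In characteristic 2, `X ^ n - 1 = (X ^ N - 1) ^ 2 ^ v` splits over
the powers of `α`, so `g` is a multiset `A` of residues. It is defined over `F` iff `A` is stable
under `2 ^ m`, self-dual iff the multiplicities of `a` and `-a` add up to `2 ^ v`, and fixed by `θ`
iff `A` is stable under `2 ^ r`. So the codes are the fixed points of `frobMap r` on
`generatorUnions`.

It remains to count all such `A`, that is, multiplicity functions on the orbits of `2 ^ m`. An orbit
equal to its negative must have multiplicity `2 ^ (v - 1)`; each pair of opposite orbits allows `2 ^
v + 1` choices. The `φ(j)` residues of additive order `j` lie in orbits of size `ord_j(2 ^ m)`,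
which are self-negative iff `(j, m)` is good (`ncard_orbitNeg_ne`). -/

namespace SkewCode

open Polynomial

/-! ### Words as remainders modulo `X ^ n - 1` -/

section Words

variable {F : Type*} [Field F] {n : ℕ}

theorem coeff_wordPoly (c : Fin n → F) (i : Fin n) : (wordPoly c).coeff i = c i := by
  simp only [wordPoly, finsetSum_coeff, coeff_C_mul, coeff_X_pow, mul_ite, mul_one, mul_zero]
  rw [Finset.sum_eq_single i]
  · simp
  · intro j _ hj
    rw [if_neg]
    intro h
    exact hj (Fin.ext h.symm)
  · simp

theorem degree_wordPoly_lt (c : Fin n → F) : (wordPoly c).degree < n := by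
  refine (degree_sum_le _ _).trans_lt ((Finset.sup_lt_iff (WithBot.bot_lt_coe n)).2 ?_)
  intro i _
  refine (degree_C_mul_X_pow_le _ _).trans_lt ?_
  exact WithBot.coe_lt_coe.2 i.2

theorem wordPoly_ext {f : F[X]} (c : Fin n → F) (hf : f.degree < n)
    (h : ∀ i : Fin n, f.coeff i = c i) : f = wordPoly c := by
  ext k
  by_cases hk : k < n
  · exact (h ⟨k, hk⟩).trans (coeff_wordPoly c ⟨k, hk⟩).symm
  · have hk : (n : WithBot ℕ) ≤ k := by exact_mod_cast not_lt.mp hk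
    rw [coeff_eq_zero_of_degree_lt (hf.trans_le hk),
      coeff_eq_zero_of_degree_lt ((degree_wordPoly_lt c).trans_le hk)]

theorem wordPoly_map (σ : F →+* F) (c : Fin n → F) :
    (wordPoly c).map σ = wordPoly fun i => σ (c i) := by
  simp [wordPoly, Polynomial.map_sum]

variable [NeZero n]

variable (F n) in
theorem monic_X_pow_sub_one : (X ^ n - 1 : F[X]).Monic := by
  simpa using monic_X_pow_sub_C (1 : F) (NeZero.ne n)

variable (F n) in
theorem degree_X_pow_sub_one : (X ^ n - 1 : F[X]).degree = n := by
  simpa using degree_X_pow_sub_C (NeZero.pos n) (1 : F)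

/-- The word of coefficients of the remainder of a polynomial modulo `X ^ n - 1`. -/
noncomputable def remWord (n : ℕ) [NeZero n] : F[X] →ₗ[F] (Fin n → F) where
  toFun f i := (f %ₘ (X ^ n - 1)).coeff i
  map_add' f g := by
    ext i
    simp [add_modByMonic]
  map_smul' t f := by
    ext i
    simp [smul_modByMonic]

theorem wordPoly_remWord (f : F[X]) : wordPoly (remWord n f) = f %ₘ (X ^ n - 1) := by
  refine (wordPoly_ext _ ?_ fun i => rfl).symm
  rw [← degree_X_pow_sub_one F n]
  exact degree_modByMonic_lt _ (monic_X_pow_sub_one F n)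

theorem X_pow_sub_one_dvd_sub_wordPoly_remWord (f : F[X]) :
    X ^ n - 1 ∣ f - wordPoly (remWord n f) := by
  rw [wordPoly_remWord]
  refine ⟨f /ₘ (X ^ n - 1), ?_⟩
  linear_combination -modByMonic_add_div f (X ^ n - 1)

theorem remWord_eq_of_dvd_sub {f : F[X]} {c : Fin n → F}
    (h : X ^ n - 1 ∣ f - wordPoly c) : remWord n f = c := by
  have h1 : X ^ n - 1 ∣ wordPoly (remWord n f) - wordPoly c := by
    have := h.sub (X_pow_sub_one_dvd_sub_wordPoly_remWord (n := n) f)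
    simpa using this
  have h2 : wordPoly (remWord n f) - wordPoly c = 0 := by
    refine eq_zero_of_dvd_of_degree_lt h1 ?_
    rw [degree_X_pow_sub_one]
    exact (degree_sub_le _ _).trans_lt
      (max_lt (degree_wordPoly_lt _) (degree_wordPoly_lt _))
  ext i
  rw [← coeff_wordPoly (remWord n f), sub_eq_zero.mp h2, coeff_wordPoly]

theorem remWord_wordPoly (c : Fin n → F) : remWord n (wordPoly c) = c :=
  remWord_eq_of_dvd_sub (by simp)

theorem remWord_eq_zero_iff {f : F[X]} : remWord n f = 0 ↔ X ^ n - 1 ∣ f := by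
  refine ⟨fun h => ?_, fun h => remWord_eq_of_dvd_sub (by simpa [wordPoly] using h)⟩
  have := X_pow_sub_one_dvd_sub_wordPoly_remWord (n := n) f
  simpa [h, wordPoly] using this

theorem dvd_wordPoly_remWord_iff {g f : F[X]} (hg : g ∣ X ^ n - 1) :
    g ∣ wordPoly (remWord n f) ↔ g ∣ f :=
  (dvd_iff_dvd_of_dvd_sub (hg.trans (X_pow_sub_one_dvd_sub_wordPoly_remWord f))).symm

/-- The top coefficient, at index `0 - 1 = n - 1`, moves to degree `n`; writing `X ^ n = (X ^ n - 1)
+ 1` wraps it around to degree `0`. -/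
theorem X_mul_wordPoly (c : Fin n → F) :
    X * wordPoly c =
      wordPoly (skewShift 1 c) + C (c (0 - 1)) * (X ^ n - 1) := by
  obtain ⟨k, rfl⟩ := Nat.exists_eq_succ_of_ne_zero (NeZero.ne n)
  have h0 : (0 : Fin (k + 1)) - 1 = Fin.last k := by
    rw [sub_eq_iff_eq_add, Fin.last_add_one]
  have hs (i : Fin k) : i.succ - 1 = i.castSucc := by
    rw [sub_eq_iff_eq_add, Fin.coeSucc_eq_succ]
  have hX : wordPoly c = ∑ i : Fin k, C (c i.castSucc) * X ^ (i : ℕ) + C (c (Fin.last k)) * X ^ k := by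
    simp [wordPoly, Fin.sum_univ_castSucc]
  have hY : wordPoly (skewShift 1 c) =
      C (c (Fin.last k)) + ∑ i : Fin k, C (c i.castSucc) * X ^ ((i : ℕ) + 1) := by
    simp [wordPoly, Fin.sum_univ_succ, skewShift, h0, hs]
  rw [hX, hY, h0, mul_add, Finset.mul_sum]
  have : ∑ i : Fin k, X * (C (c i.castSucc) * X ^ (i : ℕ)) =
      ∑ i : Fin k, C (c i.castSucc) * X ^ ((i : ℕ) + 1) :=
    Finset.sum_congr rfl fun i _ => by ring
  rw [this, Nat.succ_eq_add_one]
  ring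

theorem remWord_X_mul (f : F[X]) : remWord n (X * f) = skewShift 1 (remWord n f) := by
  refine remWord_eq_of_dvd_sub ?_
  have h1 := (X_pow_sub_one_dvd_sub_wordPoly_remWord (n := n) f).mul_left X
  rw [mul_sub, X_mul_wordPoly] at h1
  have h2 : X ^ n - 1 ∣ C (remWord n f (0 - 1)) * (X ^ n - 1 : F[X]) := dvd_mul_left _ _
  convert h1.add h2 using 1
  ring

theorem iterate_skewShift (θ : RingAut F) (k : ℕ) (c : Fin n → F) (i : Fin n) :
    (skewShift θ)^[k] c i = (θ ^ k) (c (i - k • 1)) := by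
  induction k generalizing i with
  | zero => simp
  | succ k ih =>
    rw [Function.iterate_succ_apply', skewShift, ih, pow_succ', succ_nsmul', sub_sub]
    rfl

theorem remWord_X_pow_mul (f : F[X]) (k : ℕ) (i : Fin n) :
    remWord n (X ^ k * f) i = remWord n f (i - k • 1) := by
  have : remWord n (X ^ k * f) = (skewShift 1)^[k] (remWord n f) := by
    induction k with
    | zero => simp
    | succ k ih => rw [Function.iterate_succ_apply', ← ih, ← remWord_X_mul, pow_succ', mul_assoc]
  rw [this, iterate_skewShift, one_pow]
  rfl

end Words

/-! ### Generator polynomials of cyclic codes -/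

section Generator

variable {F : Type*} [Field F] {n : ℕ}

/-- The code of length `n` of the words whose polynomials are multiples of `g`. -/
noncomputable def multiplesCode (n : ℕ) (g : F[X]) : Submodule F (Fin n → F) where
  carrier := {c | g ∣ wordPoly c}
  add_mem' := by
    intro a b ha hb
    have : wordPoly (a + b) = wordPoly a + wordPoly b := by
      simp [wordPoly, add_mul, Finset.sum_add_distrib]
    simpa [this] using dvd_add ha hb
  zero_mem' := by simp [wordPoly]
  smul_mem' := by
    intro t a ha
    have : wordPoly (t • a) = C t * wordPoly a := by
      simp [wordPoly, Finset.mul_sum, mul_assoc]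
    simpa [this] using ha.mul_left _

theorem mem_multiplesCode {g : F[X]} {c : Fin n → F} :
    c ∈ multiplesCode n g ↔ g ∣ wordPoly c := Iff.rfl

theorem isGeneratorPoly_iff {D : Submodule F (Fin n → F)} {g : F[X]} :
    IsGeneratorPoly D g ↔ g.Monic ∧ g ∣ X ^ n - 1 ∧ D = multiplesCode n g :=
  and_congr_right fun _ => and_congr_right fun _ =>
    ⟨fun h => SetLike.ext h, fun h _ => by rw [h, mem_multiplesCode]⟩

variable [NeZero n]

theorem isCyclicCode_multiplesCode {g : F[X]} (hg : g ∣ X ^ n - 1) :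
    IsCyclicCode (multiplesCode n g) := by
  intro c hc
  rw [mem_multiplesCode] at hc ⊢
  rw [← remWord_wordPoly c, ← remWord_X_mul, dvd_wordPoly_remWord_iff hg]
  exact hc.mul_left X

theorem associated_of_multiplesCode_eq {g h : F[X]} (hg : g ∣ X ^ n - 1) (hh : h ∣ X ^ n - 1)
    (e : multiplesCode n g = multiplesCode n h) : Associated g h := by
  have key (f : F[X]) : g ∣ f ↔ h ∣ f := by
    rw [← dvd_wordPoly_remWord_iff hg, ← dvd_wordPoly_remWord_iff hh, ← mem_multiplesCode, e,
      mem_multiplesCode]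
  exact associated_of_dvd_dvd ((key h).2 dvd_rfl) ((key g).1 dvd_rfl)

theorem IsGeneratorPoly.unique {D : Submodule F (Fin n → F)} {g h : F[X]}
    (hg : IsGeneratorPoly D g) (hh : IsGeneratorPoly D h) : g = h := by
  rw [isGeneratorPoly_iff] at hg hh
  exact eq_of_monic_of_associated hg.1 hh.1
    (associated_of_multiplesCode_eq hg.2.1 hh.2.1 (hg.2.2.symm.trans hh.2.2))

/-- The preimage of `D` under `remWord` is an ideal of the principal ideal domain `F[X]`: linearity
handles scalars and cyclicity handles multiplication by `X`. Its normalized generator is the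
polynomial sought. -/
theorem IsCyclicCode.exists_isGeneratorPoly {D : Submodule F (Fin n → F)} (hD : IsCyclicCode D) :
    ∃ g, IsGeneratorPoly D g := by
  classical
  let I : Ideal F[X] :=
    { D.comap (remWord n) with
      smul_mem' := by
        intro p f hf
        change remWord n (p * f) ∈ D
        change remWord n f ∈ D at hf
        induction p using Polynomial.induction_on' with
        | add p q hp hq =>
          rw [add_mul, map_add]
          exact D.add_mem hp hq
        | monomial k t =>
          rw [← smul_X_eq_monomial, smul_mul_assoc, map_smul]
          refine D.smul_mem t ?_
          induction k with
          | zero => simpa using hf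
          | succ k ih =>
            rw [pow_succ', mul_assoc, remWord_X_mul]
            exact hD _ ih }
  have hI (f : F[X]) : f ∈ I ↔ remWord n f ∈ D := Iff.rfl
  have hn : (X ^ n - 1 : F[X]) ∈ I := by
    rw [hI, remWord_eq_zero_iff.2 dvd_rfl]
    exact D.zero_mem
  obtain ⟨f, hf⟩ := (IsPrincipalIdealRing.principal I).principal
  have hmem (p : F[X]) : p ∈ I ↔ f ∣ p := by
    rw [hf]
    exact Ideal.mem_span_singleton
  have hf0 : f ≠ 0 := by
    rintro rfl
    exact (monic_X_pow_sub_one F n).ne_zero (zero_dvd_iff.1 ((hmem _).1 hn))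
  have ha : Associated (normalize f) f := normalize_associated f
  refine ⟨normalize f, monic_normalize hf0, ha.dvd_iff_dvd_left.2 ((hmem _).1 hn), fun c => ?_⟩
  rw [ha.dvd_iff_dvd_left, ← hmem, hI, remWord_wordPoly]

end Generator

/-! ### Reversal of polynomials and divisibility -/

section Reverse

variable {F : Type*} [Field F] {n : ℕ}

/-- A nonzero constant term keeps the degree from dropping, so both reversals reflect about the same
degree. -/
theorem reverse_reverse_of_coeff_zero_ne_zero {f : F[X]} (hf : f.coeff 0 ≠ 0) :
    f.reverse.reverse = f := by
  have h : f.reverse.natDegree = f.natDegree := by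
    rw [reverse_natDegree, natTrailingDegree_eq_zero_of_constantCoeff_ne_zero hf, Nat.sub_zero]
  rw [reverse, h, reverse, reflect_reflect]

theorem reverse_dvd_reflect {h f : F[X]} (hf : f.natDegree ≤ n) (hd : h ∣ f) :
    h.reverse ∣ f.reflect n := by
  obtain ⟨k, rfl⟩ := hd
  by_cases h0 : h * k = 0
  · simp [h0]
  rw [natDegree_mul (left_ne_zero_of_mul h0) (right_ne_zero_of_mul h0)] at hf
  obtain ⟨e, rfl⟩ := Nat.exists_eq_add_of_le (le_of_add_le_left hf)
  rw [reflect_mul h k le_rfl (show k.natDegree ≤ e by omega)]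
  exact dvd_mul_right _ _

theorem dvd_reflect_iff {h f : F[X]} (h0 : h.coeff 0 ≠ 0) (hf : f.natDegree ≤ n) :
    h ∣ f.reflect n ↔ h.reverse ∣ f := by
  constructor
  · intro hd
    have := reverse_dvd_reflect (natDegree_reflect_le.trans (max_le le_rfl hf)) hd
    rwa [reflect_reflect] at this
  · intro hd
    have := reverse_dvd_reflect hf hd
    rwa [reverse_reverse_of_coeff_zero_ne_zero h0] at this

theorem reverse_dvd_reverse {f g : F[X]} (h : f ∣ g) : f.reverse ∣ g.reverse := by
  obtain ⟨k, rfl⟩ := h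
  rw [reverse_mul_of_domain]
  exact dvd_mul_right _ _

theorem associated_reverse {f g : F[X]} (h : Associated f g) :
    Associated f.reverse g.reverse :=
  associated_of_dvd_dvd (reverse_dvd_reverse h.dvd) (reverse_dvd_reverse h.symm.dvd)

theorem reflect_finsetSum {ι : Type*} (s : Finset ι) (f : ι → F[X]) :
    (∑ i ∈ s, f i).reflect n = ∑ i ∈ s, (f i).reflect n := by
  ext k
  simp [coeff_reflect]

end Reverse

/-! ### The Euclidean dual of a cyclic code -/

section Dual

variable {F : Type*} [Field F] {n : ℕ} [NeZero n]

theorem val_nsmul_one (k : ℕ) : ((k • (1 : Fin n) : Fin n) : ℕ) = k % n := by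
  induction k with
  | zero => simp
  | succ k ih => rw [succ_nsmul, Fin.val_add, ih, Fin.val_one', ← Nat.add_mod]

theorem nsmul_one_val (i : Fin n) : (i : ℕ) • (1 : Fin n) = i :=
  Fin.ext ((val_nsmul_one _).trans (Nat.mod_eq_of_lt i.2))

theorem remWord_X_pow (k : ℕ) :
    remWord n (X ^ k : F[X]) 0 = if n ∣ k then 1 else 0 := by
  have h1 : remWord n (1 : F[X]) = Pi.single 0 1 := by
    refine remWord_eq_of_dvd_sub ?_
    have : wordPoly (Pi.single (0 : Fin n) (1 : F)) = 1 := by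
      rw [wordPoly, Finset.sum_eq_single 0]
      · simp
      · intro j _ hj
        simp [hj]
      · simp
    simp [this]
  have h2 : (0 : Fin n) - k • 1 = 0 ↔ n ∣ k := by
    rw [zero_sub, neg_eq_zero, Fin.ext_iff, val_nsmul_one, Nat.dvd_iff_mod_eq_zero]
    rfl
  rw [← mul_one (X ^ k), remWord_X_pow_mul, h1, Pi.single_apply]
  exact if_congr h2 rfl rfl

/-- Reflection sends `X ^ j` to `X ^ (n - j)`, which is the inverse of `X ^ j` modulo `X ^ n - 1`,
so the constant term of the product collects the terms with `i = j`. -/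
theorem sum_mul_eq_remWord (c d : Fin n → F) :
    ∑ i, c i * d i = remWord n (wordPoly c * (wordPoly d).reflect n) 0 := by
  have hd : (wordPoly d).reflect n = ∑ j : Fin n, C (d j) * X ^ (n - (j : ℕ)) := by
    rw [wordPoly, reflect_finsetSum]
    refine Finset.sum_congr rfl fun j _ => ?_
    rw [reflect_C_mul_X_pow, revAt_le j.2.le]
  rw [hd, wordPoly, Finset.sum_mul_sum, map_sum, Finset.sum_apply]
  refine Finset.sum_congr rfl fun i _ => ?_
  have hij (j : Fin n) : n ∣ (i : ℕ) + (n - (j : ℕ)) ↔ j = i := by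
    have hi := i.2
    have hj := j.2
    constructor
    · rintro ⟨t, ht⟩
      -- The exponent `i + (n - j)` lies strictly between `0` and `2 * n`.
      have : t = 1 := by
        rcases t with _ | _ | t
        · omega
        · rfl
        · nlinarith [Nat.sub_le n j, Nat.zero_le (n * t)]
      subst this
      exact Fin.ext (by omega)
    · rintro rfl
      rw [Nat.add_sub_cancel' hj.le]
  have key (j : Fin n) : remWord n (C (c i) * X ^ (i : ℕ) * (C (d j) * X ^ (n - (j : ℕ)))) 0 =
      if j = i then c i * d j else 0 := by
    have : C (c i) * X ^ (i : ℕ) * (C (d j) * X ^ (n - (j : ℕ))) =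
        (c i * d j) • (X ^ ((i : ℕ) + (n - (j : ℕ))) : F[X]) := by
      rw [smul_eq_C_mul, C_mul, pow_add]
      ring
    rw [this, map_smul, Pi.smul_apply, remWord_X_pow, if_congr (hij j) rfl rfl]
    simp
  simp [map_sum, Finset.sum_apply, key]

theorem remWord_congr {f g : F[X]} (h : X ^ n - 1 ∣ f - g) : remWord n f = remWord n g := by
  rw [← sub_eq_zero, ← map_sub, remWord_eq_zero_iff]
  exact h

theorem mem_euclideanDual_multiplesCode {g : F[X]} (hg : g ∣ X ^ n - 1) {d : Fin n → F} :
    d ∈ euclideanDual (multiplesCode n g) ↔ X ^ n - 1 ∣ g * (wordPoly d).reflect n := by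
  constructor
  · intro h
    rw [← remWord_eq_zero_iff]
    ext i
    -- Pairing with the shift of `g` by `-i` reads off the coefficient of index `i` of the product.
    have hk := h (remWord n (X ^ ((-i : Fin n) : ℕ) * g))
      ((dvd_wordPoly_remWord_iff hg).2 (dvd_mul_left _ _))
    rw [sum_mul_eq_remWord, remWord_congr (g := X ^ ((-i : Fin n) : ℕ) *
      (g * (wordPoly d).reflect n)), remWord_X_pow_mul, nsmul_one_val] at hk
    · simpa using hk
    · rw [← mul_assoc, ← sub_mul]
      refine Dvd.dvd.mul_right ?_ _
      rw [dvd_sub_comm]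
      exact X_pow_sub_one_dvd_sub_wordPoly_remWord _
  · rintro h c ⟨p, hp⟩
    rw [sum_mul_eq_remWord, hp, mul_right_comm, remWord_eq_zero_iff.2 (h.mul_right p)]
    rfl

/-- With `X ^ n - 1 = g * h`, the dual is generated by the reverse of `h`. Self-duality thus says
that `g` is associated to `h.reverse`; reversing both sides (constant terms are nonzero) and
multiplying by `g` gives the criterion. -/
theorem isSelfDual_multiplesCode_iff {g : F[X]} (hg : g ∣ X ^ n - 1) :
    IsSelfDual (multiplesCode n g) ↔ Associated (g * g.reverse) (X ^ n - 1) := by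
  obtain ⟨h, hgh⟩ := hg
  have hg : g ∣ X ^ n - 1 := ⟨h, hgh⟩
  have hh : h ∣ X ^ n - 1 := ⟨g, hgh.trans (mul_comm _ _)⟩
  have hn0 : (X ^ n - 1 : F[X]) ≠ 0 := (monic_X_pow_sub_one F n).ne_zero
  have hg0 : g ≠ 0 := by
    rintro rfl
    exact hn0 (by simpa using hgh)
  have hc : g.coeff 0 * h.coeff 0 = -1 := by
    rw [← mul_coeff_zero, ← hgh]
    simp [coeff_X_pow, (NeZero.ne n).symm]
  have hgc : g.coeff 0 ≠ 0 := fun h0 => by simp [h0] at hc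
  have hhc : h.coeff 0 ≠ 0 := fun h0 => by simp [h0] at hc
  have hrev : h.reverse ∣ X ^ n - 1 := by
    have hdeg : (X ^ n - 1 : F[X]).natDegree ≤ n :=
      natDegree_le_of_degree_le (degree_X_pow_sub_one F n).le
    have := reverse_dvd_reflect hdeg hh
    rwa [reflect_sub, reflect_one, reflect_monomial, revAt_le le_rfl, Nat.sub_self, pow_zero,
      dvd_sub_comm] at this
  have hdual : euclideanDual (multiplesCode n g) = multiplesCode n h.reverse := by
    ext d
    rw [mem_euclideanDual_multiplesCode hg, hgh, mul_dvd_mul_iff_left hg0, mem_multiplesCode]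
    exact dvd_reflect_iff hhc (natDegree_le_of_degree_le (degree_wordPoly_lt d).le)
  have h1 : IsSelfDual (multiplesCode n g) ↔ Associated g h.reverse := by
    rw [IsSelfDual, hdual]
    refine ⟨associated_of_multiplesCode_eq hg hrev, fun ha => ?_⟩
    ext c
    rw [mem_multiplesCode, mem_multiplesCode, ha.dvd_iff_dvd_left]
  have h2 : Associated g h.reverse ↔ Associated g.reverse h := by
    constructor
    · intro ha
      have := associated_reverse ha
      rwa [reverse_reverse_of_coeff_zero_ne_zero hhc] at this
    · intro ha
      have := associated_reverse ha
      rwa [reverse_reverse_of_coeff_zero_ne_zero hgc] at this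
  rw [h1, h2, hgh]
  exact ⟨fun ha => ha.mul_left g, fun ha => ha.of_mul_left (Associated.refl g) hg0⟩

end Dual

/-! ### Multisets stable under multiplication, and cyclotomic cosets -/

section CosetUnion

variable {N : ℕ}

theorem count_frobMap (hN : Odd N) (r : ℕ) (A : Multiset (ZMod N)) (a : ZMod N) :
    (frobMap r A).count ((2 : ZMod N) ^ r * a) = A.count a := by
  refine Multiset.count_map_eq_count' _ _ (IsUnit.mul_right_injective ?_) _
  refine IsUnit.pow r ?_
  simpa using (ZMod.isUnit_iff_coprime 2 N).2 (Nat.coprime_two_left.2 hN)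

theorem frobMap_eq_self_iff (hN : Odd N) {r : ℕ} {A : Multiset (ZMod N)} :
    frobMap r A = A ↔ ∀ a, A.count ((2 : ZMod N) ^ r * a) = A.count a := by
  have hu : IsUnit ((2 : ZMod N) ^ r) := by
    refine IsUnit.pow r ?_
    simpa using (ZMod.isUnit_iff_coprime 2 N).2 (Nat.coprime_two_left.2 hN)
  constructor
  · intro h a
    conv_lhs => rw [← h]
    exact count_frobMap hN r A a
  · intro h
    ext b
    obtain ⟨a, rfl⟩ : ∃ a, b = (2 : ZMod N) ^ r * a :=
      ⟨↑hu.unit⁻¹ * b, by rw [← mul_assoc, IsUnit.mul_val_inv, one_mul]⟩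
    rw [count_frobMap hN, h]

variable [NeZero N]

theorem mem_cyclotomicCoset {q : ℕ} {s a : ZMod N} :
    a ∈ cyclotomicCoset q s ↔ ∃ k : ℕ, a = (q : ZMod N) ^ k * s := by
  simp [cyclotomicCoset]

theorem mul_mem_cyclotomicCoset_iff {q : ℕ} (hq : q.Coprime N) {s a : ZMod N} :
    (q : ZMod N) * a ∈ cyclotomicCoset q s ↔ a ∈ cyclotomicCoset q s := by
  simp only [mem_cyclotomicCoset]
  constructor
  · rintro ⟨k, hk⟩
    obtain ⟨e, he, h1⟩ := isOfFinOrder_iff_pow_eq_one.1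
      (isOfFinOrder_of_finite (ZMod.unitOfCoprime q hq))
    have h1 : (q : ZMod N) ^ e = 1 := by
      have := congrArg Units.val h1
      simpa using this
    refine ⟨e - 1 + k, ?_⟩
    rw [pow_add, mul_assoc, ← hk, ← mul_assoc, ← pow_succ, Nat.sub_add_cancel he, h1, one_mul]
  · rintro ⟨k, rfl⟩
    exact ⟨k + 1, by rw [pow_succ', mul_assoc]⟩

open Classical in
theorem count_cyclotomicCoset_val {q : ℕ} {s a : ZMod N} :
    (cyclotomicCoset q s).val.count a = if a ∈ cyclotomicCoset q s then 1 else 0 :=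
  Multiset.count_eq_of_nodup (cyclotomicCoset q s).nodup

/-- Multiplicities are constant along a coset, so one copy of the coset of any member can be removed
without losing invariance; induct on `A`. -/
theorem isCosetUnion_of_count_eq {q : ℕ} (hq : q.Coprime N) (A : Multiset (ZMod N))
    (h : ∀ a, A.count ((q : ZMod N) * a) = A.count a) : IsCosetUnion q A := by
  induction A using Multiset.strongInductionOn with
  | ih A ih =>
    rcases A.empty_or_exists_mem with rfl | ⟨s, hs⟩
    · exact ⟨0, by simp⟩
    have hpow (k : ℕ) : A.count ((q : ZMod N) ^ k * s) = A.count s := by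
      induction k with
      | zero => simp
      | succ k ihk => rw [pow_succ', mul_assoc, h, ihk]
    have hle : (cyclotomicCoset q s).val ≤ A := by
      rw [Multiset.le_iff_count]
      intro a
      rw [count_cyclotomicCoset_val]
      split_ifs with ha
      · obtain ⟨k, rfl⟩ := mem_cyclotomicCoset.1 ha
        rw [hpow, Nat.succ_le_iff, Multiset.count_pos]
        exact hs
      · exact Nat.zero_le _
    have hss : s ∈ cyclotomicCoset q s := mem_cyclotomicCoset.2 ⟨0, by simp⟩
    obtain ⟨S, hS⟩ := ih (A - (cyclotomicCoset q s).val)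
      (lt_of_le_of_ne tsub_le_self fun e => by
        have h1 := congrArg (Multiset.count s) e
        rw [Multiset.count_sub, count_cyclotomicCoset_val, if_pos hss] at h1
        have h2 := Multiset.count_pos.2 hs
        omega)
      (fun a => by
        rw [Multiset.count_sub, Multiset.count_sub, h, count_cyclotomicCoset_val,
          count_cyclotomicCoset_val, if_congr (mul_mem_cyclotomicCoset_iff hq) rfl rfl])
    refine ⟨s ::ₘ S, ?_⟩
    rw [Multiset.map_cons, Multiset.sum_cons, ← hS, add_tsub_cancel_of_le hle]

end CosetUnion

/-! ### Products of linear factors over powers of `α` -/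

section RootProd

variable {K : Type*} [Field K] {N : ℕ} {α : K}

theorem pow_val_natCast (hα : IsPrimitiveRoot α N) (k : ℕ) :
    α ^ (k : ZMod N).val = α ^ k := by
  rw [ZMod.val_natCast, hα.eq_orderOf, pow_mod_orderOf]

variable (α) in
/-- The monic polynomial with roots `α ^ a` for `a` in the multiset `A`. -/
noncomputable def rootProd (A : Multiset (ZMod N)) : K[X] :=
  (A.map fun a => X - C (α ^ a.val)).prod

theorem rootProd_add (A B : Multiset (ZMod N)) :
    rootProd α (A + B) = rootProd α A * rootProd α B := by
  simp [rootProd]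

theorem monic_rootProd (A : Multiset (ZMod N)) : (rootProd α A).Monic :=
  monic_multiset_prod_of_monic _ _ fun _ _ => monic_X_sub_C _

variable [NeZero N]

theorem pow_val_injective (hα : IsPrimitiveRoot α N) :
    Function.Injective fun a : ZMod N => α ^ a.val :=
  fun a b h => ZMod.val_injective N (hα.pow_inj a.val_lt b.val_lt h)

theorem pow_val_mul (hα : IsPrimitiveRoot α N) (k : ℕ) (a : ZMod N) :
    α ^ ((k : ZMod N) * a).val = (α ^ a.val) ^ k := by
  rw [← pow_mul, mul_comm a.val, ← pow_val_natCast hα (k * a.val), Nat.cast_mul,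
    ZMod.natCast_zmod_val]

theorem pow_val_neg (hα : IsPrimitiveRoot α N) (a : ZMod N) :
    α ^ (-a).val = (α ^ a.val)⁻¹ := by
  refine eq_inv_of_mul_eq_one_left ?_
  rw [← pow_add, ← pow_val_natCast hα]
  simp

theorem rootProd_injective (hα : IsPrimitiveRoot α N) :
    Function.Injective (rootProd α : Multiset (ZMod N) → K[X]) := by
  intro A B h
  have key (A : Multiset (ZMod N)) : (rootProd α A).roots = A.map fun a => α ^ a.val := by
    have := roots_multiset_prod_X_sub_C (A.map fun a => α ^ a.val)
    rwa [Multiset.map_map] at this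
  refine Multiset.map_injective (pow_val_injective hα) ?_
  rw [← key, h, key]

/-- Factor by factor: the reverse of `X - β` is `1 - β X = -β (X - β⁻¹)`, and inverting `α ^ a`
negates `a`. -/
theorem associated_reverse_rootProd (hα : IsPrimitiveRoot α N) (A : Multiset (ZMod N)) :
    Associated (rootProd α A).reverse (rootProd α (A.map Neg.neg)) := by
  induction A using Multiset.induction_on with
  | empty =>
    have : (1 : K[X]).reverse = 1 := reverse_C 1
    simp [rootProd, this]
  | cons a A ih =>
    have h0 : α ^ a.val ≠ 0 := pow_ne_zero _ (hα.ne_zero (NeZero.ne N))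
    have h1 : Associated (X - C (α ^ a.val)).reverse (X - C (α ^ (-a).val)) := by
      have hr : (X - C (α ^ a.val)).reverse = (X - C (α ^ (-a).val)) * C (-α ^ a.val) := by
        have h2 : (X : K[X]).reverse = 1 := by
          rw [← one_mul X, reverse_mul_X]
          exact reverse_C 1
        have h3 := reverse_add_C (X : K[X]) (-α ^ a.val)
        rw [natDegree_X, pow_one, h2, C_neg, ← sub_eq_add_neg] at h3
        rw [h3, pow_val_neg hα, sub_mul, ← C_mul, mul_neg, inv_mul_cancel₀ h0, C_neg, C_neg, C_1]
        ring
      rw [hr]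
      exact associated_mul_unit_left _ _ (isUnit_C.2 (neg_ne_zero.2 h0).isUnit)
    have := h1.mul_mul ih
    rw [← reverse_mul_of_domain] at this
    simpa [rootProd] using this

theorem X_pow_sub_one_eq_rootProd [CharP K 2] (hα : IsPrimitiveRoot α N) (v : ℕ) :
    X ^ (2 ^ v * N) - 1 = rootProd α (2 ^ v • (Finset.univ : Finset (ZMod N)).val) := by
  classical
  have hset : nthRootsFinset N (1 : K) = Finset.univ.image fun a : ZMod N => α ^ a.val := by
    symm
    refine Finset.eq_of_subset_of_card_le ?_ ?_
    · intro x hx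
      obtain ⟨a, -, rfl⟩ := Finset.mem_image.1 hx
      rw [mem_nthRootsFinset (NeZero.pos N), ← pow_mul, mul_comm, pow_mul, hα.pow_eq_one, one_pow]
    · rw [hα.card_nthRootsFinset, Finset.card_image_of_injective _ (pow_val_injective hα),
        Finset.card_univ, ZMod.card]
  have h1 : (X ^ N - 1 : K[X]) = rootProd α (Finset.univ : Finset (ZMod N)).val := by
    rw [X_pow_sub_one_eq_prod (NeZero.pos N) hα, hset,
      Finset.prod_image fun a _ b _ h => pow_val_injective hα h]
    rfl
  have : (X ^ (2 ^ v * N) - 1 : K[X]) = (X ^ N - 1) ^ 2 ^ v := by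
    rw [sub_pow_char_pow, one_pow, ← pow_mul, mul_comm]
  rw [this, h1, rootProd, rootProd, Multiset.map_nsmul, Multiset.prod_nsmul]

theorem map_iterateFrobenius_rootProd [CharP K 2] (hα : IsPrimitiveRoot α N) (r : ℕ)
    (A : Multiset (ZMod N)) :
    (rootProd α A).map (iterateFrobenius K 2 r) = rootProd α (frobMap r A) := by
  have h (a : ZMod N) : α ^ ((2 : ZMod N) ^ r * a).val = (α ^ a.val) ^ 2 ^ r := by
    rw [← pow_val_mul hα, Nat.cast_pow, Nat.cast_ofNat]
  rw [rootProd, rootProd, frobMap, Polynomial.map_multiset_prod, Multiset.map_map,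
    Multiset.map_map]
  congr 1
  refine Multiset.map_congr rfl fun a _ => ?_
  simp only [Function.comp_apply]
  rw [h, Polynomial.map_sub, map_X, map_C, iterateFrobenius_def]

end RootProd

/-! ### Descent from `K` to `F` -/

section Represents

variable {F K : Type*} [Field F] [Field K] [Algebra F K] {N : ℕ} {α : K}

theorem represents_iff {A : Multiset (ZMod N)} {g : F[X]} :
    Represents α A g ↔ g.map (algebraMap F K) = rootProd α A := Iff.rfl

theorem Represents.monic {A : Multiset (ZMod N)} {g : F[X]} (h : Represents α A g) : g.Monic := by
  refine monic_of_injective (algebraMap F K).injective ?_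
  rw [represents_iff.1 h]
  exact monic_rootProd A

theorem Represents.poly_unique {A : Multiset (ZMod N)} {g g' : F[X]} (h : Represents α A g)
    (h' : Represents α A g') : g = g' :=
  map_injective _ (algebraMap F K).injective
    ((represents_iff.1 h).trans (represents_iff.1 h').symm)

theorem reverse_map_algebraMap (g : F[X]) :
    (g.map (algebraMap F K)).reverse = g.reverse.map (algebraMap F K) := by
  rw [reverse, reverse, natDegree_map, reflect_map]

theorem associated_map_iff {f g : F[X]} :
    Associated (f.map (algebraMap F K)) (g.map (algebraMap F K)) ↔ Associated f g := by
  rw [← dvd_dvd_iff_associated, ← dvd_dvd_iff_associated, map_dvd_map', map_dvd_map']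

/-- Over `F`, `X ^ q - X` is the product of all `X - b`; evaluating it at `x` makes some factor
vanish. -/
theorem mem_range_algebraMap_of_pow_card_eq [Finite F] {x : K} (hx : x ^ Nat.card F = x) :
    x ∈ (algebraMap F K).range := by
  have := Fintype.ofFinite F
  rw [Nat.card_eq_fintype_card] at hx
  have hp : (X ^ Fintype.card F - X : F[X]) = ∏ b : F, (X - C b) := by
    have h1 := FiniteField.X_pow_card_sub_X_natDegree_eq F (Fintype.one_lt_card (α := F))
    have h2 : (X ^ Fintype.card F - X : F[X]).Monic :=
      monic_X_pow_sub (by rw [degree_X]; exact_mod_cast Fintype.one_lt_card (α := F))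
    have h3 := prod_multiset_X_sub_C_of_monic_of_roots_card_eq h2 (by
      rw [FiniteField.roots_X_pow_card_sub_X, h1]
      rfl)
    rw [FiniteField.roots_X_pow_card_sub_X] at h3
    exact h3.symm
  have h := congrArg (aeval x) hp
  simp only [map_sub, map_pow, aeval_X, map_prod, aeval_C, hx, sub_self] at h
  obtain ⟨b, -, hb⟩ := Finset.prod_eq_zero_iff.1 h.symm
  exact ⟨b, (sub_eq_zero.1 hb).symm⟩

variable [NeZero N]

theorem Represents.multiset_unique (hα : IsPrimitiveRoot α N) {A B : Multiset (ZMod N)} {g : F[X]}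
    (h : Represents α A g) (h' : Represents α B g) : A = B :=
  rootProd_injective hα ((represents_iff.1 h).symm.trans (represents_iff.1 h'))

/-- Stability of `A` makes every coefficient of its product a fixed point of the `q`-power map,
hence an element of `F`. -/
theorem exists_represents [Finite F] [CharP K 2] {m : ℕ} (hF : Nat.card F = 2 ^ m)
    (hα : IsPrimitiveRoot α N) {A : Multiset (ZMod N)} (hA : frobMap m A = A) :
    ∃ g : F[X], Represents α A g := by
  have h := map_iterateFrobenius_rootProd hα m A
  rw [hA] at h
  have hl : rootProd α A ∈ lifts (algebraMap F K) := by
    rw [lifts_iff_coeff_lifts]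
    intro k
    refine mem_range_algebraMap_of_pow_card_eq ?_
    conv_rhs => rw [← h]
    rw [coeff_map, iterateFrobenius_def, hF]
  exact hl

theorem Represents.frobMap_eq_self [Finite F] [CharP K 2] {m : ℕ} (hF : Nat.card F = 2 ^ m)
    (hα : IsPrimitiveRoot α N) {A : Multiset (ZMod N)} {g : F[X]} (h : Represents α A g) :
    frobMap m A = A := by
  refine rootProd_injective hα ?_
  rw [← map_iterateFrobenius_rootProd hα, ← represents_iff.1 h, Polynomial.map_map]
  congr 1
  ext x
  have := Fintype.ofFinite F
  rw [RingHom.comp_apply, iterateFrobenius_def, ← hF, ← map_pow, Nat.card_eq_fintype_card,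
    FiniteField.pow_card]

theorem Represents.associated_mul_reverse_iff [CharP K 2] (hα : IsPrimitiveRoot α N) (v : ℕ)
    {A : Multiset (ZMod N)} {g : F[X]} (h : Represents α A g) :
    Associated (g * g.reverse) (X ^ (2 ^ v * N) - 1) ↔
      ∀ a, A.count a + A.count (-a) = 2 ^ v := by
  have h1 : Associated (rootProd α A * (rootProd α A).reverse) (rootProd α (A + A.map Neg.neg)) := by
    rw [rootProd_add]
    exact (associated_reverse_rootProd hα A).mul_left _
  rw [← associated_map_iff (K := K), Polynomial.map_mul, ← reverse_map_algebraMap,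
    represents_iff.1 h, Polynomial.map_sub, Polynomial.map_pow, map_X, Polynomial.map_one,
    X_pow_sub_one_eq_rootProd hα]
  have h2 : Associated (rootProd α (A + A.map Neg.neg))
      (rootProd α (2 ^ v • (Finset.univ : Finset (ZMod N)).val)) ↔
      A + A.map Neg.neg = 2 ^ v • (Finset.univ : Finset (ZMod N)).val :=
    ⟨fun ha => rootProd_injective hα
      (eq_of_monic_of_associated (monic_rootProd _) (monic_rootProd _) ha), fun e => by rw [e]⟩
  rw [show Associated (rootProd α A * (rootProd α A).reverse) _ ↔ _ from
    ⟨h1.symm.trans, h1.trans⟩, h2, Multiset.ext]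
  refine forall_congr' fun a => ?_
  have h3 : (A.map Neg.neg).count a = A.count (-a) := by
    have := Multiset.count_map_eq_count' (Neg.neg : ZMod N → ZMod N) A neg_injective (-a)
    rwa [neg_neg] at this
  rw [Multiset.count_add, h3, Multiset.count_nsmul,
    Multiset.count_eq_one_of_mem Finset.univ.nodup (Finset.mem_univ a), mul_one]

end Represents

/-! ### Skew cyclic codes as `θ`-stable cyclic codes -/

section SkewCyclic

variable {F : Type*} [Field F] {n : ℕ} {θ : RingAut F} {D : Submodule F (Fin n → F)}

theorem pow_comp_mem (h : ∀ c ∈ D, (fun i => θ (c i)) ∈ D) (k : ℕ) :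
    ∀ c ∈ D, (fun i => (θ ^ k) (c i)) ∈ D := by
  induction k with
  | zero =>
    intro c hc
    simpa using hc
  | succ k ih =>
    intro c hc
    have := h _ (ih c hc)
    simpa [pow_succ'] using this

theorem inv_comp_mem (hθ : IsOfFinOrder θ) (h : ∀ c ∈ D, (fun i => θ (c i)) ∈ D) :
    ∀ c ∈ D, (fun i => θ⁻¹ (c i)) ∈ D := by
  have : θ ^ (orderOf θ - 1) = θ⁻¹ := by
    rw [eq_inv_iff_mul_eq_one, ← pow_succ, Nat.sub_add_cancel hθ.orderOf_pos, pow_orderOf_eq_one]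
  rw [← this]
  exact pow_comp_mem h _

theorem isSkewCyclic_iff [NeZero n] (hθ : IsOfFinOrder θ) (hcop : n.Coprime (orderOf θ)) :
    IsSkewCyclic θ D ↔ IsCyclicCode D ∧ ∀ c ∈ D, (fun i => θ (c i)) ∈ D := by
  constructor
  · intro h
    have hit (k : ℕ) : ∀ c ∈ D, (skewShift θ)^[k] c ∈ D := by
      induction k with
      | zero => exact fun c hc => hc
      | succ k ih =>
        intro c hc
        rw [Function.iterate_succ_apply']
        exact h _ (ih c hc)
    have hs : ∀ c ∈ D, (fun i => θ (c i)) ∈ D := by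
      intro c hc
      -- Here `(θ ^ n) ^ k = θ`, while `n * k` shifts move no coordinate.
      obtain ⟨k, hk⟩ := exists_pow_eq_self_of_coprime hcop
      have h0 : (n * k) • (1 : Fin n) = 0 :=
        Fin.ext ((val_nsmul_one _).trans (by simp))
      convert hit (n * k) c hc using 1
      ext i
      rw [iterate_skewShift, h0, sub_zero, pow_mul, hk]
    refine ⟨fun c hc => ?_, hs⟩
    convert inv_comp_mem hθ hs _ (h c hc) using 1
    ext i
    simp only [skewShift]
    exact (RingEquiv.symm_apply_apply θ _).symm
  · rintro ⟨h, hs⟩ c hc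
    exact hs _ (h c hc)

theorem IsGeneratorPoly.comp_mem_iff_map_eq [NeZero n] (hθ : IsOfFinOrder θ) {g : F[X]}
    (hg : IsGeneratorPoly D g) :
    (∀ c ∈ D, (fun i => θ (c i)) ∈ D) ↔ g.map (θ : F →+* F) = g := by
  constructor
  · intro h
    -- The image of `g` under `θ` generates `θ(D)`, which is `D` because `D` is stable under both
    -- `θ` and `θ⁻¹`.
    refine IsGeneratorPoly.unique (D := D) ⟨hg.1.map _, ?_, fun c => ?_⟩ hg
    · simpa using Polynomial.map_dvd (θ : F →+* F) hg.2.1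
    · have hc : wordPoly c = (wordPoly fun i => θ⁻¹ (c i)).map (θ : F →+* F) := by
        rw [wordPoly_map]
        congr 1
        ext i
        exact (RingEquiv.apply_symm_apply θ _).symm
      rw [hc, map_dvd_map', ← hg.2.2]
      refine ⟨inv_comp_mem hθ h c, fun hc' => ?_⟩
      convert h _ hc' using 1
      ext i
      exact (RingEquiv.apply_symm_apply θ _).symm
  · intro h c hc
    rw [hg.2.2] at hc ⊢
    have := Polynomial.map_dvd (θ : F →+* F) hc
    rwa [h, wordPoly_map] at this

end SkewCyclic

/-! ### Divisors of split products -/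

section Divisors

variable {K : Type*} [Field K] {N : ℕ} {α : K}

theorem exists_eq_rootProd_of_dvd {p : K[X]} (hp : p.Monic) {B : Multiset (ZMod N)}
    (h : p ∣ rootProd α B) : ∃ A : Multiset (ZMod N), p = rootProd α A := by
  have hs : p.Splits :=
    (Splits.multisetProd fun f hf => by
      obtain ⟨a, -, rfl⟩ := Multiset.mem_map.1 hf
      exact Splits.X_sub_C _).of_dvd (monic_rootProd B).ne_zero h
  have hroot (x : K) (hx : x ∈ p.roots) : ∃ a : ZMod N, α ^ a.val = x := by
    have := ((mem_roots'.1 hx).2).dvd h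
    rw [IsRoot, rootProd, eval_multiset_prod, Multiset.map_map, Multiset.prod_eq_zero_iff,
      Multiset.mem_map] at this
    obtain ⟨a, -, ha⟩ := this
    exact ⟨a, by simpa [sub_eq_zero, eq_comm (a := x)] using ha⟩
  choose! f hf using hroot
  refine ⟨p.roots.map f, ?_⟩
  conv_lhs => rw [hs.eq_prod_roots_of_monic hp]
  rw [rootProd, Multiset.map_map]
  congr 1
  refine Multiset.map_congr rfl fun x hx => ?_
  rw [Function.comp_apply, hf x hx]

end Divisors

/-! ### Self-dual codes as balanced multisets -/

section Representation

variable {F K : Type*} [Field F] [Field K] [Algebra F K] {N : ℕ} [NeZero N] {α : K}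

theorem exists_multiset_represents [CharP K 2] (hα : IsPrimitiveRoot α N) {v : ℕ} {g : F[X]}
    (hm : g.Monic) (hg : g ∣ X ^ (2 ^ v * N) - 1) : ∃ A : Multiset (ZMod N), Represents α A g := by
  have := Polynomial.map_dvd (algebraMap F K) hg
  rw [Polynomial.map_sub, Polynomial.map_pow, map_X, Polynomial.map_one,
    X_pow_sub_one_eq_rootProd hα] at this
  exact exists_eq_rootProd_of_dvd (hm.map _) this

theorem Represents.map_ringAut [CharP K 2] (hα : IsPrimitiveRoot α N) {θ : RingAut F} {r : ℕ}
    (hθ : ∀ β : F, θ β = β ^ 2 ^ r) {A : Multiset (ZMod N)} {g : F[X]} (h : Represents α A g) :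
    Represents α (frobMap r A) (g.map (θ : F →+* F)) := by
  rw [represents_iff, ← map_iterateFrobenius_rootProd hα, ← represents_iff.1 h,
    Polynomial.map_map, Polynomial.map_map]
  congr 1
  ext x
  simp [hθ, iterateFrobenius_def]

theorem Represents.map_eq_self_iff [CharP K 2] (hα : IsPrimitiveRoot α N) {θ : RingAut F} {r : ℕ}
    (hθ : ∀ β : F, θ β = β ^ 2 ^ r) {A : Multiset (ZMod N)} {g : F[X]} (h : Represents α A g) :
    g.map (θ : F →+* F) = g ↔ frobMap r A = A := by
  have h' := h.map_ringAut hα hθ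
  constructor
  · intro e
    rw [e] at h'
    exact h'.multiset_unique hα h
  · intro e
    rw [e] at h'
    exact h'.poly_unique h

/-- The multisets of residues modulo `N` that are invariant under multiplication by `2 ^ m` and
in which the multiplicities of `a` and `-a` add up to `M`. -/
def balancedMultisets (N m M : ℕ) : Set (Multiset (ZMod N)) :=
  {A | frobMap m A = A ∧ ∀ a, A.count a + A.count (-a) = M}

variable [Finite F] [CharP K 2] {n m v r : ℕ} [NeZero n]

theorem generatorUnions_eq_balancedMultisets (hF : Nat.card F = 2 ^ m) (hN : Odd N)
    (hn : n = 2 ^ v * N) (hα : IsPrimitiveRoot α N) :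
    generatorUnions F n N α = balancedMultisets N m (2 ^ v) := by
  ext A
  constructor
  · rintro ⟨-, D, g, -, hsd, hgen, hrep⟩
    refine ⟨hrep.frobMap_eq_self hF hα, ?_⟩
    obtain ⟨-, hg, rfl⟩ := isGeneratorPoly_iff.1 hgen
    rw [isSelfDual_multiplesCode_iff hg, hn] at hsd
    exact (hrep.associated_mul_reverse_iff hα v).1 hsd
  · rintro ⟨h1, h2⟩
    obtain ⟨g, hg⟩ := exists_represents hF hα h1
    have ha := (hg.associated_mul_reverse_iff hα v).2 h2
    rw [← hn] at ha
    have hd : g ∣ X ^ n - 1 := (dvd_mul_right _ _).trans ha.dvd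
    refine ⟨?_, multiplesCode n g, g, isCyclicCode_multiplesCode hd,
      (isSelfDual_multiplesCode_iff hd).2 ha, isGeneratorPoly_iff.2 ⟨hg.monic, hd, rfl⟩, hg⟩
    rw [hF]
    refine isCosetUnion_of_count_eq ((Nat.coprime_two_left.2 hN).pow_left m) A ?_
    simpa using (frobMap_eq_self_iff hN).1 h1

theorem ncard_skewCyclic_selfDual (hF : Nat.card F = 2 ^ m) (hN : Odd N)
    (hn : n = 2 ^ v * N) (hα : IsPrimitiveRoot α N) {θ : RingAut F}
    (hθ : ∀ β : F, θ β = β ^ 2 ^ r) (hfin : IsOfFinOrder θ) (hcop : n.Coprime (orderOf θ)) :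
    {C : Submodule F (Fin n → F) | IsSelfDual C ∧ IsSkewCyclic θ C}.ncard =
      {A ∈ generatorUnions F n N α | frobMap r A = A}.ncard := by
  symm
  -- The choice is harmless: `A` determines `g`, and `g` determines the code.
  refine Set.ncard_congr (fun A hA => hA.1.2.choose) ?_ ?_ ?_
  · intro A hA
    obtain ⟨g, hcyc, hsd, hgen, hrep⟩ := hA.1.2.choose_spec
    exact ⟨hsd, (isSkewCyclic_iff hfin hcop).2
      ⟨hcyc, (hgen.comp_mem_iff_map_eq hfin).2 ((hrep.map_eq_self_iff hα hθ).2 hA.2)⟩⟩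
  · intro A B hA hB e
    obtain ⟨g, -, -, hgen, hrep⟩ := hA.1.2.choose_spec
    obtain ⟨g', -, -, hgen', hrep'⟩ := hB.1.2.choose_spec
    rw [← e] at hgen'
    rw [← hgen.unique hgen'] at hrep'
    exact hrep.multiset_unique hα hrep'
  · rintro C ⟨hsd, hskew⟩
    obtain ⟨hcyc, hst⟩ := (isSkewCyclic_iff hfin hcop).1 hskew
    obtain ⟨g, hgen⟩ := hcyc.exists_isGeneratorPoly
    obtain ⟨A, hrep⟩ := exists_multiset_represents hα (v := v) hgen.1 (hn ▸ hgen.2.1)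
    have hA : A ∈ generatorUnions F n N α := by
      refine ⟨?_, C, g, hcyc, hsd, hgen, hrep⟩
      rw [hF]
      refine isCosetUnion_of_count_eq ((Nat.coprime_two_left.2 hN).pow_left m) A ?_
      simpa using (frobMap_eq_self_iff hN).1 (hrep.frobMap_eq_self hF hα)
    refine ⟨A, ⟨hA, ?_⟩, ?_⟩
    · exact (hrep.map_eq_self_iff hα hθ).1 ((hgen.comp_mem_iff_map_eq hfin).1 hst)
    · obtain ⟨g', -, -, hgen', hrep'⟩ := hA.2.choose_spec
      rw [hrep'.poly_unique hrep] at hgen'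
      exact (isGeneratorPoly_iff.1 hgen').2.2.trans (isGeneratorPoly_iff.1 hgen).2.2.symm

end Representation

/-! ### Balanced functions for an involution -/

section Involution

variable {Q : Type*} [Finite Q]

/-- A fixed point forces the value `M / 2`, which is where evenness enters; on a pair `{x, ν x}` one
value in `0, …, M` is free and determines the other. -/
theorem exists_ncard_balanced_eq_pow {ν : Q → Q} (hν : Function.Involutive ν) {M : ℕ}
    (hM : Even M) :
    ∃ k, {x | ν x ≠ x}.ncard = 2 * k ∧
      {e : Q → ℕ | ∀ x, e x + e (ν x) = M}.ncard = (M + 1) ^ k := by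
  classical
  obtain ⟨N, ⟨i⟩⟩ := Finite.exists_equiv_fin Q
  -- An arbitrary order serves only to pick one representative, with `x < ν x`, from each pair.
  let _ : LinearOrder Q := LinearOrder.lift' i i.injective
  let T : Set Q := {x | x < ν x}
  have hT : ν '' T = {x | ν x < x} := by
    ext x
    constructor
    · rintro ⟨y, hy, rfl⟩
      have hy : y < ν y := hy
      simpa [hν y] using hy
    · intro hx
      exact ⟨ν x, by simpa [T, hν x] using hx, hν x⟩
  refine ⟨T.ncard, ?_, ?_⟩
  · have hu : {x | ν x ≠ x} = T ∪ ν '' T := by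
      ext x
      rw [hT]
      simp only [Set.mem_ofPred_eq, Set.mem_union, T]
      exact ne_comm.trans lt_or_lt_iff_ne.symm
    have hd : Disjoint T (ν '' T) := by
      rw [hT, Set.disjoint_left]
      exact fun x (hx : x < ν x) (hx' : ν x < x) => lt_asymm hx hx'
    rw [hu, Set.ncard_union_eq hd, Set.ncard_image_of_injective _ hν.injective, two_mul]
  · let f : {e : Q → ℕ | ∀ x, e x + e (ν x) = M} → (T → Fin (M + 1)) :=
      fun e x => ⟨e.1 x, by have := e.2 x; omega⟩
    have hf : Function.Bijective f := by
      constructor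
      · rintro ⟨e, he⟩ ⟨e', he'⟩ h
        have h1 (x : Q) (hx : x < ν x) : e x = e' x :=
          congrArg Fin.val (congrFun h ⟨x, hx⟩)
        refine Subtype.ext (funext fun x => ?_)
        have hx := he x
        have hx' := he' x
        rcases lt_trichotomy x (ν x) with hlt | heq | hgt
        · exact h1 x hlt
        · simp only [← heq] at hx hx'
          change e x = e' x
          omega
        · have := h1 (ν x) (by rwa [hν x])
          change e x = e' x
          omega
      · intro s
        refine ⟨⟨fun x => if h : x < ν x then s ⟨x, h⟩ else
          if h' : ν x < x then M - s ⟨ν x, by simpa [T, hν x] using h'⟩ else M / 2, ?_⟩, ?_⟩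
        · intro x
          obtain ⟨t, rfl⟩ := hM
          simp only [hν x]
          rcases lt_trichotomy x (ν x) with hlt | heq | hgt
          · have := (s ⟨x, hlt⟩).2
            rw [dif_pos hlt, dif_neg hlt.le.not_gt, dif_pos hlt]
            omega
          · rw [dif_neg heq.not_lt, dif_neg heq.not_gt, dif_neg heq.not_gt, dif_neg heq.not_lt]
            omega
          · have := (s ⟨ν x, by simpa [T, hν x] using hgt⟩).2
            rw [dif_neg hgt.le.not_gt, dif_pos hgt, dif_pos hgt]
            omega
        · funext x
          exact Fin.ext (dif_pos x.2)
    rw [← Nat.card_coe_set_eq, Nat.card_congr (Equiv.ofBijective f hf), Nat.card_fun,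
      Nat.card_fin, Nat.card_coe_set_eq]

end Involution

/-! ### Orbits of multiplication by `2 ^ m` -/

section Orbits

open MulAction

variable {N : ℕ}

theorem pow_mul_eq_self_iff (m k : ℕ) (a : ZMod N) :
    ((2 : ZMod N) ^ m) ^ k * a = a ↔ ((2 : ZMod (addOrderOf a)) ^ m) ^ k = 1 := by
  -- With `s = 2 ^ (m k) - 1`, both sides say that the additive order of `a` divides `s`.
  obtain ⟨s, hs⟩ := Nat.exists_eq_add_of_lt (pow_pos (pow_pos two_pos m) k : 0 < (2 ^ m) ^ k)
  rw [zero_add] at hs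
  have h (R : Type) [CommRing R] : ((2 : R) ^ m) ^ k = s + 1 := by
    have := congrArg (Nat.cast (R := R)) hs
    push_cast at this
    exact this
  rw [h, h, add_mul, one_mul, add_eq_right, add_eq_right, ZMod.natCast_eq_zero_iff,
    addOrderOf_dvd_iff_nsmul_eq_zero, nsmul_eq_mul]

theorem exists_neg_eq_pow_mul_iff (m : ℕ) (a : ZMod N) :
    (∃ k : ℕ, -a = ((2 : ZMod N) ^ m) ^ k * a) ↔ IsGood (addOrderOf a) m := by
  refine exists_congr fun k => ?_
  rw [addOrderOf_dvd_iff_nsmul_eq_zero, nsmul_eq_mul, neg_eq_iff_add_eq_zero]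
  push_cast
  rw [add_mul, one_mul, add_comm]

/-- The unit `2 ^ m` modulo an odd number. -/
noncomputable def twoPowUnit (hN : Odd N) (m : ℕ) : (ZMod N)ˣ :=
  ZMod.unitOfCoprime (2 ^ m) ((Nat.coprime_two_left.2 hN).pow_left m)

theorem val_twoPowUnit (hN : Odd N) (m : ℕ) : (twoPowUnit hN m : ZMod N) = 2 ^ m := by
  simp [twoPowUnit]

/-- The set of orbits of multiplication by `2 ^ m` on residues modulo `N`. -/
abbrev TwoPowOrbits (hN : Odd N) (m : ℕ) : Type :=
  orbitRel.Quotient (Subgroup.zpowers (twoPowUnit hN m)) (ZMod N)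

/-- The orbit of a residue under multiplication by `2 ^ m`. -/
noncomputable def toOrbit (hN : Odd N) (m : ℕ) (a : ZMod N) : TwoPowOrbits hN m :=
  Quotient.mk'' a

theorem minimalPeriod_twoPowUnit (hN : Odd N) (m : ℕ) (a : ZMod N) :
    Function.minimalPeriod (twoPowUnit hN m • ·) a = orderOf ((2 : ZMod (addOrderOf a)) ^ m) := by
  rw [orderOf, Function.minimalPeriod_eq_minimalPeriod_iff]
  intro k
  rw [isPeriodicPt_mul_iff_pow_eq_one, ← pow_mul_eq_self_iff, Function.IsPeriodicPt,
    Function.IsFixedPt, smul_iterate]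
  change ((twoPowUnit hN m ^ k : (ZMod N)ˣ) : ZMod N) * a = a ↔ _
  rw [Units.val_pow_eq_pow_val, val_twoPowUnit]

theorem toOrbit_eq_iff (hN : Odd N) (m : ℕ) {a b : ZMod N} :
    toOrbit hN m a = toOrbit hN m b ↔ ∃ k : ℕ, a = ((2 : ZMod N) ^ m) ^ k * b := by
  rw [toOrbit, toOrbit, Quotient.eq'', orbitRel_apply]
  constructor
  · rintro ⟨⟨w, hw⟩, rfl⟩
    -- The unit group is finite, so nonnegative exponents suffice.
    obtain ⟨k, rfl⟩ := (mem_powers_iff_mem_zpowers (x := twoPowUnit hN m)).2 hw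
    refine ⟨k, ?_⟩
    change ((twoPowUnit hN m ^ k : (ZMod N)ˣ) : ZMod N) * b = _
    rw [Units.val_pow_eq_pow_val, val_twoPowUnit]
  · rintro ⟨k, rfl⟩
    refine ⟨⟨twoPowUnit hN m ^ k, k, by simp⟩, ?_⟩
    change ((twoPowUnit hN m ^ k : (ZMod N)ˣ) : ZMod N) * b = _
    rw [Units.val_pow_eq_pow_val, val_twoPowUnit]

theorem toOrbit_surjective (hN : Odd N) (m : ℕ) : Function.Surjective (toOrbit hN m) :=
  Quotient.mk''_surjective

/-- The involution of the set of orbits induced by negation. -/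
noncomputable def orbitNeg (hN : Odd N) (m : ℕ) : TwoPowOrbits hN m → TwoPowOrbits hN m :=
  Quotient.lift (fun a => toOrbit hN m (-a)) fun a b h => by
    have h' : toOrbit hN m a = toOrbit hN m b := Quotient.sound h
    obtain ⟨k, rfl⟩ := (toOrbit_eq_iff hN m).1 h'
    exact (toOrbit_eq_iff hN m).2 ⟨k, by rw [mul_neg]⟩

theorem orbitNeg_toOrbit (hN : Odd N) (m : ℕ) (a : ZMod N) :
    orbitNeg hN m (toOrbit hN m a) = toOrbit hN m (-a) := rfl

theorem orbitNeg_involutive (hN : Odd N) (m : ℕ) : Function.Involutive (orbitNeg hN m) := by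
  intro x
  obtain ⟨a, rfl⟩ := toOrbit_surjective hN m x
  rw [orbitNeg_toOrbit, orbitNeg_toOrbit, neg_neg]

theorem mapsTo_frobMap_balancedMultisets (hN : Odd N) (m M r : ℕ) :
    Set.MapsTo (frobMap r) (balancedMultisets N m M) (balancedMultisets N m M) := by
  rintro A ⟨h1, h2⟩
  have hu (a : ZMod N) : ∃ b, (2 : ZMod N) ^ r * b = a :=
    ⟨↑(twoPowUnit hN r)⁻¹ * a, by rw [← val_twoPowUnit hN, Units.mul_inv_cancel_left]⟩
  refine ⟨?_, fun a => ?_⟩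
  · conv_rhs => rw [← h1]
    simp only [frobMap, Multiset.map_map, Function.comp_def, mul_left_comm]
  · obtain ⟨b, rfl⟩ := hu a
    rw [← mul_neg, count_frobMap hN, count_frobMap hN, h2]

variable [NeZero N]

instance finite_twoPowOrbits (hN : Odd N) (m : ℕ) : Finite (TwoPowOrbits hN m) :=
  Finite.of_surjective _ (toOrbit_surjective hN m)

open Classical in
theorem card_filter_toOrbit_eq (hN : Odd N) (m : ℕ) (a : ZMod N) :
    (Finset.univ.filter fun b => toOrbit hN m b = toOrbit hN m a).card =
      orderOf ((2 : ZMod (addOrderOf a)) ^ m) := by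
  rw [← minimalPeriod_twoPowUnit hN, minimalPeriod_eq_card, ← Fintype.card_subtype]
  refine Fintype.card_congr (Equiv.subtypeEquivRight fun b => ?_)
  rw [toOrbit, toOrbit, Quotient.eq'', orbitRel_apply]

open Classical in
theorem ncard_orbitNeg_ne (hN : Odd N) (m : ℕ) :
    ({x | orbitNeg hN m x ≠ x}.ncard : ℝ) = ∑ j ∈ N.divisors,
      (chi j m : ℝ) * (Nat.totient j : ℝ) / (orderOf ((2 : ZMod j) ^ m) : ℝ) := by
  have := Fintype.ofFinite (TwoPowOrbits hN m)
  -- Each orbit moved by negation has total weight 1, spread evenly over its elements. Summing over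
  -- residues and regrouping by additive order `j` gives the formula.
  let w (j : ℕ) : ℝ := (chi j m : ℝ) / (orderOf ((2 : ZMod j) ^ m) : ℝ)
  have h1 : ({x | orbitNeg hN m x ≠ x}.ncard : ℝ) = ∑ a : ZMod N, w (addOrderOf a) := by
    rw [← Finset.sum_fiberwise Finset.univ (toOrbit hN m), Set.ncard_eq_toFinset_card',
      Finset.card_eq_sum_ones, Nat.cast_sum, Set.toFinset_ofPred, Finset.sum_filter]
    refine Finset.sum_congr rfl fun x _ => ?_
    obtain ⟨a, rfl⟩ := toOrbit_surjective hN m x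
    have hcard (b : ZMod N) (hb : toOrbit hN m b = toOrbit hN m a) :
        orderOf ((2 : ZMod (addOrderOf b)) ^ m) = orderOf ((2 : ZMod (addOrderOf a)) ^ m) := by
      rw [← card_filter_toOrbit_eq hN, ← card_filter_toOrbit_eq hN, hb]
    have hgood (b : ZMod N) : IsGood (addOrderOf b) m ↔
        orbitNeg hN m (toOrbit hN m b) = toOrbit hN m b := by
      rw [← exists_neg_eq_pow_mul_iff, orbitNeg_toOrbit, toOrbit_eq_iff]
    have hw : ∀ b ∈ Finset.univ.filter fun b => toOrbit hN m b = toOrbit hN m a,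
        w (addOrderOf b) = w (addOrderOf a) := by
      intro b hb
      rw [Finset.mem_filter] at hb
      simp only [w, chi, hgood, hb.2, hcard b hb.2]
    have hpos : 0 < orderOf ((2 : ZMod (addOrderOf a)) ^ m) := by
      rw [← card_filter_toOrbit_eq hN, Finset.card_pos]
      exact ⟨a, by simp⟩
    rw [Finset.sum_congr rfl hw, Finset.sum_const, card_filter_toOrbit_eq, nsmul_eq_mul]
    have hne : (orderOf ((2 : ZMod (addOrderOf a)) ^ m) : ℝ) ≠ 0 := by exact_mod_cast hpos.ne'
    simp only [w, chi, hgood, ne_eq, ite_not]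
    rw [mul_div_cancel₀ _ hne]
    split_ifs <;> simp
  have hdvd (a : ZMod N) : addOrderOf a ∣ N := by
    simpa using addOrderOf_dvd_card (x := a)
  rw [h1, ← Finset.sum_fiberwise_of_maps_to (t := N.divisors) (g := fun a => addOrderOf a)
    fun a _ => Nat.mem_divisors.2 ⟨hdvd a, NeZero.ne N⟩]
  refine Finset.sum_congr rfl fun j hj => ?_
  have hw : ∀ b ∈ Finset.univ.filter fun b : ZMod N => addOrderOf b = j,
      w (addOrderOf b) = w j := by
    intro b hb
    rw [(Finset.mem_filter.1 hb).2]
  rw [Finset.sum_congr rfl hw, Finset.sum_const, IsAddCyclic.card_addOrderOf_eq_totient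
    (by simpa using (Nat.mem_divisors.1 hj).1), nsmul_eq_mul]
  simp only [w]
  ring

/-- A multiset is its multiplicity function, and invariance under `2 ^ m` says that this function
factors through the orbits. -/
theorem ncard_balancedMultisets (hN : Odd N) (m M : ℕ) :
    (balancedMultisets N m M).ncard =
      {e : TwoPowOrbits hN m → ℕ | ∀ x, e x + e (orbitNeg hN m x) = M}.ncard := by
  symm
  have hcount (e : ZMod N → ℕ) (a : ZMod N) :
      (∑ b, Multiset.replicate (e b) b).count a = e a := by
    simp [Multiset.count_sum', Multiset.count_replicate]
  refine Set.ncard_congr (fun e _ => ∑ b, Multiset.replicate (e (toOrbit hN m b)) b) ?_ ?_ ?_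
  · intro e he
    refine ⟨(frobMap_eq_self_iff hN).2 fun a => ?_, fun a => ?_⟩
    · rw [hcount fun b => e (toOrbit hN m b), hcount fun b => e (toOrbit hN m b)]
      congr 1
      exact (toOrbit_eq_iff hN m).2 ⟨1, by rw [pow_one]⟩
    · rw [hcount fun b => e (toOrbit hN m b), hcount fun b => e (toOrbit hN m b)]
      exact he (toOrbit hN m a)
  · intro e e' _ _ h
    funext x
    obtain ⟨a, rfl⟩ := toOrbit_surjective hN m x
    have := congrArg (Multiset.count a) h
    rwa [hcount fun b => e (toOrbit hN m b), hcount fun b => e' (toOrbit hN m b)] at this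
  · rintro A ⟨h1, h2⟩
    rw [frobMap_eq_self_iff hN] at h1
    have hpow (k : ℕ) (a : ZMod N) : A.count (((2 : ZMod N) ^ m) ^ k * a) = A.count a := by
      induction k with
      | zero => simp
      | succ k ih => rw [pow_succ', mul_assoc, h1, ih]
    let e : TwoPowOrbits hN m → ℕ := Quotient.lift (fun a => A.count a) fun a b h => by
      have h' : toOrbit hN m a = toOrbit hN m b := Quotient.sound h
      obtain ⟨k, rfl⟩ := (toOrbit_eq_iff hN m).1 h'
      exact hpow k b
    have he (a : ZMod N) : e (toOrbit hN m a) = A.count a := rfl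
    refine ⟨e, fun x => ?_, ?_⟩
    · obtain ⟨a, rfl⟩ := toOrbit_surjective hN m x
      rw [orbitNeg_toOrbit, he, he, h2]
    · ext a
      rw [hcount fun b => e (toOrbit hN m b), he]

theorem ncard_balancedMultisets_eq_cyclicCount (hN : Odd N) (m : ℕ) {v : ℕ} (hv : v ≠ 0) :
    ((balancedMultisets N m (2 ^ v)).ncard : ℝ) = cyclicCount v N m := by
  obtain ⟨k, h1, h2⟩ := exists_ncard_balanced_eq_pow (orbitNeg_involutive hN m)
    (M := 2 ^ v) ((even_two).pow_of_ne_zero hv)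
  rw [cyclicCount, ← ncard_orbitNeg_ne hN, h1, ncard_balancedMultisets hN, h2]
  push_cast
  -- The sum equals `2 * k`, so the real power is an ordinary `k`-th power.
  rw [one_div, inv_mul_cancel_left₀ two_ne_zero, Real.rpow_natCast, add_comm]

theorem finite_balancedMultisets (m M : ℕ) : (balancedMultisets N m M).Finite := by
  refine (Set.finite_Iic (M • (Finset.univ : Finset (ZMod N)).val)).subset ?_
  rintro A ⟨-, h⟩
  rw [Set.mem_Iic, Multiset.le_iff_count]
  intro a
  rw [Multiset.count_nsmul, Multiset.count_eq_one_of_mem Finset.univ.nodup (Finset.mem_univ a),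
    mul_one, ← h a]
  exact Nat.le_add_right _ _

end Orbits

end SkewCode

theorem mainTheorem1 {F K : Type*} [Field F] [Finite F] [Field K] [Algebra F K]
    (m v N n r : ℕ) [NeZero n] [NeZero N]
    (hF : Nat.card F = 2 ^ m) (hN : Odd N) (hn : n = 2 ^ v * N) (hev : Even n)
    (θ : RingAut F) (hr : r ∈ Finset.Icc 1 m) (hθ : ∀ β : F, θ β = β ^ 2 ^ r)
    (hcop : Nat.Coprime n (orderOf θ))
    (α : K) (hα : IsPrimitiveRoot α N) :
    (SkewCode.generatorUnions F n N α).Finite ∧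
    Set.MapsTo (SkewCode.frobMap r) (SkewCode.generatorUnions F n N α)
      (SkewCode.generatorUnions F n N α) ∧
    (({C : Submodule F (Fin n → F) |
        SkewCode.IsSelfDual C ∧ SkewCode.IsSkewCyclic θ C}.ncard : ℕ) : ℝ) =
      SkewCode.cyclicCount v N m -
        (({A ∈ SkewCode.generatorUnions F n N α |
          SkewCode.frobMap r A ≠ A}.ncard : ℕ) : ℝ) := by
  have hm : m ≠ 0 := by
    have := Finset.mem_Icc.1 hr
    omega
  have hv : v ≠ 0 := by
    rintro rfl
    rw [pow_zero, one_mul] at hn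
    exact Nat.not_even_iff_odd.2 (hn ▸ hN) hev
  have hF2 : CharP F 2 := by
    have := Fintype.ofFinite F
    obtain ⟨p, hp⟩ := CharP.exists F
    obtain ⟨e, hpp, he⟩ := FiniteField.card F p
    rw [← Nat.card_eq_fintype_card, hF] at he
    have : p = 2 := (Nat.prime_dvd_prime_iff_eq hpp Nat.prime_two).1
      (hpp.dvd_of_dvd_pow (he ▸ dvd_pow_self p e.ne_zero))
    exact this ▸ hp
  have hK2 : CharP K 2 := charP_of_injective_algebraMap (algebraMap F K).injective 2
  -- `orderOf` is `0` for infinite order; coprimality would then force `n = 1`, which is not even.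
  have hfin : IsOfFinOrder θ := by
    rw [← orderOf_ne_zero_iff]
    intro h0
    rw [h0, Nat.coprime_zero_right] at hcop
    rw [hcop] at hev
    exact Nat.not_even_one hev
  have hgen := SkewCode.generatorUnions_eq_balancedMultisets (n := n) hF hN hn hα
  have hfinite : (SkewCode.generatorUnions F n N α).Finite :=
    hgen ▸ SkewCode.finite_balancedMultisets m (2 ^ v)
  refine ⟨hfinite, hgen ▸ SkewCode.mapsTo_frobMap_balancedMultisets hN m (2 ^ v) r, ?_⟩
  rw [SkewCode.ncard_skewCyclic_selfDual hF hN hn hα hθ hfin hcop,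
    ← SkewCode.ncard_balancedMultisets_eq_cyclicCount hN m hv, ← hgen, eq_sub_iff_add_eq,
    ← Nat.cast_add]
  congr 1
  have hdisj : Disjoint {A ∈ SkewCode.generatorUnions F n N α | SkewCode.frobMap r A = A}
      {A ∈ SkewCode.generatorUnions F n N α | SkewCode.frobMap r A ≠ A} :=
    Set.disjoint_left.2 fun A h h' => h'.2 h.2
  rw [← Set.ncard_union_eq hdisj (hfinite.subset (Set.sep_subset _ _))
    (hfinite.subset (Set.sep_subset _ _))]
  congr 1
  ext A
  simp only [Set.mem_union, Set.mem_ofPred_eq]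
  tauto
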